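/- Conventions. A morphism of schemes $f\colon Y\to X$ is a \emph{covering space} (profinite-\'etale) if $Y$ is, as an $X$-scheme, a cofiltered inverse limit of finite \'etale $X$-schemes. It is \emph{Yoneda trivial} if it has a set $S$ of sections such that $\operatorname{Maps}(Z,X)\times S\to\operatorname{Maps}(Z,Y)$, $(g,s)\mapsto s\circ g$, is a bijection for every connected scheme $Z$. A connected scheme is \emph{simply connected} if all its covering spaces are Yoneda trivial, and a \emph{universal cover} of a connected scheme $X$ is a covering space $\tilde X\to X$ with $\tilde X$ connected and simply connected. Proposition. Let $k$ be a field of characteristic $p>0$ with $p$ odd, let $\mathbb{G}_a=\operatorname{Spec} k[t]$ be the additive group over $k$ with addition $a\colon \mathbb{G}_a\times_k\mathbb{G}_a\to\mathbb{G}_a$, and let $\pi\colon\tilde{\mathbb{G}}_a\to\mathbb{G}_a$ be a universal cover, regarded as a $k$-scheme through $\pi$. Then the group law of $\mathbb{G}_a$ does not lift to $\tilde{\mathbb{G}}_a$: there is no morphism of $k$-schemes $m\colon\tilde{\mathbb{G}}_a\times_k\tilde{\mathbb{G}}_a\to\tilde{\mathbb{G}}_a$ with $\pi\circ m=a\circ(\pi\times\pi)$,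 and, in particular, there is no structure of a group scheme over $k$ on $\tilde{\mathbb{G}}_a$ for which $\pi$ is a homomorphism of group schemes over $k$. -/

import Mathlib

open CategoryTheory MonoidalCategory CartesianMonoidalCategory MonObj Opposite AlgebraicGeometry

universe u

noncomputable section

namespace UnivCover

/-- A morphism of schemes is finite étale if it is finite and étale. -/
def IsFiniteEtale {X Y : Scheme.{u}} (f : Y ⟶ X) : Prop :=
  IsFinite f ∧ Etale f

/-- A covering space of `X` is a profinite-étale morphism `f : Y ⟶ X`: as an `X`-scheme, `Y` is a
small cofiltered limit of finite étale `X`-schemes. (The transition maps are then affine, so the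
limit is the relative spectrum of the filtered colimit of the corresponding algebras.) -/
def IsCoveringSpace {X Y : Scheme.{u}} (f : Y ⟶ X) : Prop :=
  ∃ (J : Type u) (_ : SmallCategory J) (_ : IsCofiltered J) (D : J ⥤ Over X)
    (c : Limits.Cone D) (_ : Limits.IsLimit c),
    (∀ j, IsFiniteEtale (D.obj j).hom) ∧ Nonempty (c.pt ≅ Over.mk f)

/-- A morphism `f : Y ⟶ X` is Yoneda trivial if there is a set `S` of sections of `f` such that
`(g, s) ↦ g ≫ s` is a bijection `Maps(Z, X) × S → Maps(Z, Y)` for every connected scheme `Z`. -/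
def IsYonedaTrivial {X Y : Scheme.{u}} (f : Y ⟶ X) : Prop :=
  ∃ S : Set (X ⟶ Y), (∀ s ∈ S, s ≫ f = 𝟙 X) ∧
    ∀ Z : Scheme.{u}, ConnectedSpace Z →
      Function.Bijective (fun q : (Z ⟶ X) × S ↦ q.1 ≫ (q.2 : X ⟶ Y))

/-- A scheme is simply connected if it is connected and all its covering spaces are
Yoneda trivial. -/
def IsSimplyConnected (X : Scheme.{u}) : Prop :=
  ConnectedSpace X ∧
    ∀ (Y : Scheme.{u}) (f : Y ⟶ X), IsCoveringSpace f → IsYonedaTrivial f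

/-- A universal cover of a (connected) scheme is a covering space that is (connected and)
simply connected. -/
def IsUniversalCover {X Y : Scheme.{u}} (f : Y ⟶ X) : Prop :=
  IsCoveringSpace f ∧ IsSimplyConnected Y

/-- The functor of points of the additive group over `S`: it sends an `S`-scheme `T` to the
additive group `Γ(T, 𝒪_T)` (written multiplicatively, as group objects are in Mathlib). -/
def gaFunctor (S : Scheme.{u}) : (Over S)ᵒᵖ ⥤ GrpCat.{u} where
  obj T := GrpCat.of (Multiplicative Γ(T.unop.left, ⊤))
  map f := GrpCat.ofHom (AddMonoidHom.toMultiplicative f.unop.left.appTop.hom.toAddMonoidHom)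
  map_id T := by
    ext x
    simp
  map_comp f g := by
    refine GrpCat.hom_ext (MonoidHom.ext fun x ↦ ?_)
    change Multiplicative.ofAdd ((g.unop ≫ f.unop).left.appTop (Multiplicative.toAdd x)) = _
    rw [Over.comp_left, Scheme.Hom.comp_appTop]
    rfl

/-- The scheme underlying the additive group over `S`: the affine line. -/
def Ga (S : Scheme.{u}) : Over S :=
  Over.mk (𝔸(PUnit.{u + 1}; S) ↘ S)

/-- The affine line represents `T ↦ Γ(T, 𝒪_T)`, by pulling back the coordinate. -/
def gaRepresentableBy (S : Scheme.{u}) :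
    (gaFunctor S ⋙ forget GrpCat.{u}).RepresentableBy (Ga S) where
  homEquiv {T} :=
    { toFun f := Multiplicative.ofAdd (f.left.appTop (AffineSpace.coord S PUnit.unit))
      invFun a := Over.homMk (AffineSpace.homOfVector T.hom fun _ ↦ Multiplicative.toAdd a)
        (AffineSpace.homOfVector_over _ _)
      left_inv f := by
        ext1
        apply AffineSpace.hom_ext
        · exact (AffineSpace.homOfVector_over _ _).trans (Over.w f).symm
        · intro i
          exact AffineSpace.homOfVector_appTop_coord _ _ _
      right_inv a := by
        exact AffineSpace.homOfVector_appTop_coord _ _ _ }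
  homEquiv_comp {T T'} f g := by
    simp
    rfl

/-- The additive group `𝔾_a` over `S` as a group scheme. -/
instance gaGrpObj (S : Scheme.{u}) : GrpObj (Ga S) :=
  GrpObj.ofRepresentableBy (Ga S) (gaFunctor S) (gaRepresentableBy S)

end UnivCover

end

/-! Let `A` be the ring of functions on the universal cover and `t` the pulled-back coordinate. The
Artin–Schreier cover for `t ^ 2` is finite étale, so simple connectedness gives `y` in `A` with `y ^
p - y = t ^ 2`. A lift of addition pulls `y` back to an element of `A ⊗ A`; subtracting `y ⊗ 1 + 1 ⊗
y` leaves `g` with `g ^ p - g = 2 • (t ⊗ t)`, and `2 ≠ 0` as `p` is odd. Iterating Frobenius writes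
`g ^ p ^ n - g` as a tensor of rank `n`, because `t` is transcendental. But `g ^ p ^ n` needs no
more pure tensors than `g`, so the rank stays bounded: a contradiction. -/

open scoped TensorProduct in
/-- A tensor `∑ xᵢ ⊗ yᵢ` with linearly independent `xᵢ` and `yᵢ` is not a sum of fewer pure
tensors. -/
theorem LinearIndependent.card_le_of_sum_tmul_eq {k A B I J : Type*} [Field k] [AddCommGroup A]
    [Module k A] [AddCommGroup B] [Module k B] [Fintype I] [Fintype J] {x : I → A} {y : I → B}
    (hx : LinearIndependent k x) (hy : LinearIndependent k y) (a : J → A) (b : J → B)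
    (h : ∑ i, x i ⊗ₜ[k] y i = ∑ j, a j ⊗ₜ[k] b j) : Fintype.card I ≤ Fintype.card J := by
  classical
  obtain ⟨L, hL⟩ := LinearMap.exists_leftInverse_of_injective (Finsupp.linearCombination k x)
    (LinearMap.ker_eq_bot.2 hx)
  have hLx (i : I) : L (x i) = Finsupp.single i 1 := by
    simpa using LinearMap.congr_fun hL (Finsupp.single i 1)
  -- Contracting the left factor with the `i`-th coordinate of `L` isolates `y i`.
  have hmem (i : I) : y i ∈ Submodule.span k (Set.range b) := by
    have e := congrArg (TensorProduct.lid k B ∘ (LinearMap.rTensor B (Finsupp.lapply i ∘ₗ L))) h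
    simp only [Function.comp_apply, map_sum, LinearMap.rTensor_tmul, LinearMap.comp_apply, hLx,
      Finsupp.lapply_apply, TensorProduct.lid_tmul, Finsupp.single_apply, ite_smul, one_smul,
      zero_smul, Finset.sum_ite_eq', Finset.mem_univ, if_true] at e
    rw [e]
    exact Submodule.sum_mem _ fun j _ ↦ Submodule.smul_mem _ _
      (Submodule.subset_span (Set.mem_range_self j))
  have h1 := linearIndependent_le_span' y hy (Set.range b) (Set.range_subset_iff.2 hmem)
  rw [Cardinal.mk_fintype, Nat.cast_le] at h1
  exact h1.trans (Fintype.card_range_le b)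

open scoped TensorProduct in
/-- The Artin–Schreier equation `g ^ p - g = c • (t ⊗ t)` has no solution in `A ⊗ A` if `t` is
transcendental: the tensor ranks of the `g ^ (p ^ n)` would be unbounded. -/
theorem pow_sub_ne_smul_tmul {k A : Type*} [Field k] [CommRing A] [Algebra k A] (p : ℕ)
    [Fact p.Prime] [CharP k p] {c : k} (hc : c ≠ 0) {t : A}
    (ht : LinearIndependent k fun i : ℕ ↦ t ^ i) (g : A ⊗[k] A) :
    g ^ p - g ≠ c • (t ⊗ₜ[k] t) := by
  classical
  intro hG
  have : Nontrivial A := ⟨_, _, ht.ne_zero 0⟩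
  have : ExpChar k p := .prime Fact.out
  have : ExpChar (A ⊗[k] A) p :=
    expChar_of_injective_algebraMap (algebraMap k (A ⊗[k] A)).injective p
  obtain ⟨s, hs⟩ := TensorProduct.exists_finset g
  -- Telescoping: the equation is raised to the power `p ^ n`, which is additive.
  have key (n : ℕ) : g ^ p ^ n = g + ∑ i : Fin n, (c ^ p ^ (i : ℕ) • t ^ p ^ (i : ℕ)) ⊗ₜ[k]
      (t ^ p ^ (i : ℕ)) := by
    induction n with
    | zero => simp
    | succ n ih =>
      have e := congrArg (· ^ p ^ n) (sub_eq_iff_eq_add.1 hG)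
      simp only [← pow_mul, ← pow_succ', add_pow_expChar_pow, smul_pow,
        Algebra.TensorProduct.tmul_pow] at e
      rw [e, ih, Fin.sum_univ_castSucc]
      simp [TensorProduct.smul_tmul', add_comm, add_left_comm]
  have hinj (n : ℕ) : Function.Injective fun i : Fin n ↦ p ^ (i : ℕ) :=
    (Nat.pow_right_injective (Fact.out : p.Prime).two_le).comp Fin.val_injective
  have hy (n : ℕ) : LinearIndependent k fun i : Fin n ↦ t ^ p ^ (i : ℕ) := ht.comp _ (hinj n)
  have hx (n : ℕ) : LinearIndependent k fun i : Fin n ↦ c ^ p ^ (i : ℕ) • t ^ p ^ (i : ℕ) :=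
    (hy n).units_smul fun i ↦ Units.mk0 c hc ^ p ^ (i : ℕ)
  -- One copy of `s` serves `g ^ p ^ n`, the other `-g`; the bound does not depend on `n`.
  have hle (n : ℕ) : Fintype.card (Fin n) ≤ Fintype.card (s ⊕ s) := by
    refine (hx n).card_le_of_sum_tmul_eq (hy n)
      (Sum.elim (fun j ↦ j.1.1 ^ p ^ n) fun j ↦ -j.1.1)
      (Sum.elim (fun j ↦ j.1.2 ^ p ^ n) fun j ↦ j.1.2) ?_
    rw [← sub_eq_iff_eq_add'.2 (key n), Fintype.sum_sum_type, hs, sum_pow_char_pow]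
    simp only [Sum.elim_inl, Sum.elim_inr, TensorProduct.neg_tmul, Finset.sum_neg_distrib,
      Algebra.TensorProduct.tmul_pow, sub_eq_add_neg]
    rw [← Finset.sum_coe_sort s, ← Finset.sum_coe_sort s]
  simpa using hle (Fintype.card (s ⊕ s) + 1)

namespace UnivCover

/-! ### Artin–Schreier covers -/

section
open Polynomial

/-- The Artin–Schreier polynomial `X ^ p - X - g`. -/
noncomputable def artinSchreierPoly {A : Type u} [CommRing A] (p : ℕ) (g : A) : A[X] :=
  X ^ p - (X + C g)

theorem monic_artinSchreierPoly {A : Type u} [CommRing A] {p : ℕ} (hp : 2 ≤ p) (g : A) :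
    (artinSchreierPoly p g).Monic := by
  refine monic_X_pow_sub ?_
  refine ((degree_add_le _ _).trans (max_le degree_X_le (degree_C_le.trans ?_))).trans_lt
    (b := 1) ?_
  · exact zero_le_one
  · exact_mod_cast hp

/-- The standard étale pair given by `X ^ p - X - g` in characteristic `p`. -/
noncomputable def artinSchreierPair {A : Type u} [CommRing A] {p : ℕ} (hp : 2 ≤ p)
    (hA : (p : A) = 0) (g : A) : StandardEtalePair A where
  f := artinSchreierPoly p g
  monic_f := monic_artinSchreierPoly hp g
  g := 1
  -- The derivative is `-1`, so inverting `1` suffices.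
  cond := ⟨-1, 0, 1, by simp [artinSchreierPoly, derivative_X_pow, hA]⟩

theorem hasMap_artinSchreierPair_iff {A B : Type*} [CommRing A] [CommRing B] [Algebra A B] {p : ℕ}
    (hp : 2 ≤ p) (hA : (p : A) = 0) (g : A) (x : B) :
    (artinSchreierPair hp hA g).HasMap x ↔ x ^ p - x = algebraMap A B g := by
  simp [StandardEtalePair.HasMap, artinSchreierPair, artinSchreierPoly,
    sub_eq_iff_eq_add']

theorem finite_artinSchreierPair {A : Type u} [CommRing A] {p : ℕ} (hp : 2 ≤ p)
    (hA : (p : A) = 0) (g : A) : Module.Finite A (artinSchreierPair hp hA g).Ring := by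
  let P := artinSchreierPair hp hA g
  have : Module.Finite A (AdjoinRoot P.f) := P.monic_f.finite_adjoinRoot
  let e := (IsLocalization.atUnit (AdjoinRoot P.f) (Localization.Away (AdjoinRoot.mk P.f P.g))
    (AdjoinRoot.mk P.f P.g) (isUnit_one.map (AdjoinRoot.mk P.f)))
  exact .equiv ((e.restrictScalars A).trans P.equivAwayAdjoinRoot.symm).toLinearEquiv

/-- Supplies a connected test scheme `Spec K` mapping to the cover. -/
theorem exists_ringHom_artinSchreierPair {A : Type u} [CommRing A] [Nontrivial A] {p : ℕ}
    (hp : 2 ≤ p) (hA : (p : A) = 0) (g : A) : ∃ (K : Type u) (_ : Field K),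
      Nonempty ((artinSchreierPair hp hA g).Ring →+* K) := by
  obtain ⟨M, hM⟩ := Ideal.exists_maximal A
  let F := A ⧸ M
  let _ : Field F := Ideal.Quotient.field M
  let K := AlgebraicClosure F
  let _ : Algebra A K := ((algebraMap F K).comp (Ideal.Quotient.mk M)).toAlgebra
  have hm := monic_artinSchreierPoly hp (algebraMap A K g)
  obtain ⟨x, hx⟩ := IsAlgClosed.exists_root (artinSchreierPoly p (algebraMap A K g)) (by
    intro h0
    have h1 := hm.degree_le_zero_iff_eq_one.1 h0.le
    have h2 := congrArg (coeff · p) h1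
    simp only [artinSchreierPoly, coeff_sub, coeff_X_pow, coeff_add, coeff_X, coeff_C, coeff_one,
      if_true] at h2
    rw [if_neg (by omega), if_neg (by omega), if_neg (by omega)] at h2
    simp at h2)
  refine ⟨K, inferInstance, ⟨((artinSchreierPair hp hA g).lift x
    ((hasMap_artinSchreierPair_iff hp hA g x).2 ?_)).toRingHom⟩⟩
  simpa [artinSchreierPoly, sub_eq_zero, sub_eq_iff_eq_add'] using hx

end

/-! ### Covering spaces and simple connectedness -/

/-- A finite étale morphism is a covering space. -/
theorem IsFiniteEtale.isCoveringSpace {X Y : Scheme.{u}} {f : Y ⟶ X} (hf : IsFiniteEtale f) :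
    IsCoveringSpace f :=
  ⟨Discrete PUnit.{u + 1}, inferInstance, inferInstance, _, _,
    Limits.isLimitConstCone (Discrete PUnit.{u + 1}) (Over.mk f), fun _ ↦ hf, ⟨Iso.refl _⟩⟩

/-- The set of sections may be empty a priori; surjectivity at one connected test scheme rules this
out. -/
theorem IsYonedaTrivial.exists_section {X Y Z : Scheme.{u}} [ConnectedSpace Z] {f : Y ⟶ X}
    (hf : IsYonedaTrivial f) (z : Z ⟶ Y) : ∃ s : X ⟶ Y, s ≫ f = 𝟙 X := by
  obtain ⟨S, hS, h⟩ := hf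
  obtain ⟨⟨-, s⟩, -⟩ := (h Z inferInstance).2 z
  exact ⟨s, hS s s.2⟩

/-- The Artin–Schreier equation is solvable on a simply connected affine scheme of
characteristic `p`. -/
theorem IsSimplyConnected.exists_pow_sub_eq {X : Scheme.{u}} [IsAffine X]
    (hX : IsSimplyConnected X) {p : ℕ} (hp : 2 ≤ p) (hA : (p : Γ(X, ⊤)) = 0) (g : Γ(X, ⊤)) :
    ∃ y : Γ(X, ⊤), y ^ p - y = g := by
  have := hX.1
  let P := artinSchreierPair hp hA g
  have : Nonempty X := hX.1.toNonempty
  have : Nontrivial Γ(X, ⊤) := by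
    have : Nonempty (⊤ : X.Opens) := ⟨⟨Classical.arbitrary X, trivial⟩⟩
    exact Scheme.component_nontrivial X ⊤
  obtain ⟨K, _, ⟨φ⟩⟩ := exists_ringHom_artinSchreierPair hp hA g
  let φ₀ : Γ(X, ⊤) ⟶ CommRingCat.of P.Ring := CommRingCat.ofHom (algebraMap _ _)
  have hfe : IsFiniteEtale (Spec.map φ₀ ≫ X.isoSpec.inv) := by
    have h1 : IsFinite (Spec.map φ₀) :=
      (IsFinite.SpecMap_iff φ₀).2 (RingHom.finite_algebraMap.2 (finite_artinSchreierPair hp hA g))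
    have h2 : Etale (Spec.map φ₀) := (HasRingHomProperty.Spec_iff (P := @Etale)).2
      (RingHom.etale_algebraMap.2 inferInstance)
    exact ⟨inferInstance, inferInstance⟩
  obtain ⟨s, hs⟩ := (hX.2 _ _ hfe.isCoveringSpace).exists_section
    (Spec.map (CommRingCat.ofHom φ) : Spec (CommRingCat.of K) ⟶ Spec (CommRingCat.of P.Ring))
  let ψ : CommRingCat.of P.Ring ⟶ Γ(X, ⊤) := (Scheme.ΓSpecIso _).inv ≫ s.appTop
  have hψ : φ₀ ≫ ψ = 𝟙 _ := by
    have h1 : s ≫ Spec.map φ₀ = X.toSpecΓ := by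
      rw [← Category.assoc, Iso.comp_inv_eq, Category.id_comp] at hs
      exact hs
    have h2 := congrArg Scheme.Hom.appTop h1
    rw [Scheme.Hom.comp_appTop, Scheme.toSpecΓ_appTop] at h2
    rw [Scheme.ΓSpecIso_inv_naturality_assoc, h2, Iso.inv_hom_id]
  refine ⟨ψ P.X, ?_⟩
  have h1 := (hasMap_artinSchreierPair_iff hp hA g P.X).1 P.hasMap_X
  rw [← map_pow, ← map_sub, h1]
  exact ConcreteCategory.congr_hom hψ g

open Limits in
/-- A covering space of an affine scheme is affine and, if the base is integral and the cover is
nonempty, has injective pullback of functions. -/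
theorem IsCoveringSpace.isAffine_and_injective {X Y : Scheme.{u}} [IsAffine X] [IsIntegral X]
    [Nonempty Y] {f : Y ⟶ X} (hf : IsCoveringSpace f) :
    IsAffine Y ∧ Function.Injective f.appTop := by
  obtain ⟨J, _, _, D, c, hc, hD, ⟨e⟩⟩ := hf
  have : IsConnected J := IsCofiltered.isConnected J
  let hc' := isLimitOfPreserves (Over.forget X) hc
  have haff (j : J) : IsAffine ((D ⋙ Over.forget X).obj j) := by
    let q : (D.obj j).left ⟶ X := (D.obj j).hom
    have : IsFinite q := (hD j).1
    have h : IsAffine (D.obj j).left := isAffine_of_isAffineHom q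
    exact h
  have : IsAffine c.pt.left := Scheme.isAffine_of_isLimit _ hc'
  let e' : c.pt.left ≅ Y := (Over.forget X).mapIso e
  have he' : e'.hom ≫ f = c.pt.hom := Over.w e.hom
  have : IsAffine Y := .of_isIso e'.inv
  refine ⟨this, (injective_iff_map_eq_zero f.appTop.hom).2 fun a ha ↦ ?_⟩
  obtain ⟨j⟩ := IsCofiltered.nonempty (C := J)
  have hj : (c.π.app j).left.appTop ((D.obj j).hom.appTop a) = 0 := by
    have : (c.π.app j).left ≫ (D.obj j).hom = e'.hom ≫ f := (Over.w _).trans he'.symm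
    rw [← CommRingCat.comp_apply, ← Scheme.Hom.comp_appTop, this, Scheme.Hom.comp_appTop,
      CommRingCat.comp_apply]
    exact (congrArg e'.hom.appTop ha).trans (map_zero e'.hom.appTop.hom)
  -- A function that vanishes on the limit already vanishes at a finite stage.
  obtain ⟨i, u, hi⟩ := exists_appTop_map_eq_zero_of_isAffine_of_isLimit _ _ hc' j _ hj
  have hi' : (D.obj i).hom.appTop a = 0 := by
    rw [← Over.w (D.map u), Scheme.Hom.comp_appTop, CommRingCat.comp_apply]
    exact hi
  by_contra ha0
  have : IsAffine (D.obj i).left := haff i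
  have : Nonempty (D.obj i).left := .map (e'.inv ≫ (c.π.app i).left) ‹_›
  let q : (D.obj i).left ⟶ X := (D.obj i).hom
  have : Etale q := (hD i).2
  have hfl : q.appTop.hom.Flat := q.flat_appTop
  let _ : Algebra Γ(X, ⊤) Γ((D.obj i).left, ⊤) := q.appTop.hom.toAlgebra
  have : Module.Flat Γ(X, ⊤) Γ((D.obj i).left, ⊤) := hfl
  -- By flatness a nonzero `a` stays regular on the nonempty stage `i`, where it is zero.
  have hreg : IsSMulRegular Γ((D.obj i).left, ⊤) a :=
    (IsRegular.of_ne_zero ha0).left.isSMulRegular.of_flat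
  have : Nonempty (⊤ : (D.obj i).left.Opens) := ⟨⟨Classical.arbitrary _, trivial⟩⟩
  have : Nontrivial Γ((D.obj i).left, ⊤) := Scheme.component_nontrivial _ ⊤
  refine one_ne_zero (α := Γ((D.obj i).left, ⊤)) (hreg ?_)
  change a • 1 = a • 0
  rw [Algebra.smul_def, _root_.mul_one, smul_zero]
  exact hi'

/-! ### The additive group and the obstruction to lifting -/

section
variable {k : Type u} [Field k]

/-- The structure map from `k` to the global functions on a `k`-scheme. -/
noncomputable def scalars (Y : Over (Spec (CommRingCat.of k))) : k →+* Γ(Y.left, ⊤) :=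
  Y.hom.appTop.hom.comp (Scheme.ΓSpecIso (CommRingCat.of k)).inv.hom

theorem appTop_comp_scalars {Y Z : Over (Spec (CommRingCat.of k))} (f : Y ⟶ Z) :
    f.left.appTop.hom.comp (scalars Z) = scalars Y := by
  rw [scalars, scalars, ← RingHom.comp_assoc, ← CommRingCat.hom_comp, ← Scheme.Hom.comp_appTop,
    Over.w]

theorem isoSpec_inv_comp_hom (Y : Over (Spec (CommRingCat.of k))) [IsAffine Y.left] :
    Y.left.isoSpec.inv ≫ Y.hom = Spec.map (CommRingCat.ofHom (scalars Y)) := by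
  rw [← Scheme.isoSpec_inv_naturality, Scheme.isoSpec_Spec_inv, ← Spec.map_comp]
  rfl

theorem appTop_isoSpec_inv_comp (X : Scheme.{u}) [IsAffine X] :
    X.isoSpec.inv.appTop ≫ (Scheme.ΓSpecIso Γ(X, ⊤)).hom = 𝟙 _ := by
  rw [← Scheme.toSpecΓ_appTop, ← Scheme.Hom.comp_appTop, Scheme.toSpecΓ_isoSpec_inv,
    Scheme.Hom.id_appTop]

/-- The coordinate function on the additive group. -/
noncomputable def gaCoord (S : Scheme.{u}) : Γ((Ga S).left, ⊤) :=
  AffineSpace.coord S PUnit.unit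

/-- The function on `Y` that corresponds to a morphism from `Y` to the additive group. -/
noncomputable def gaFunction {S : Scheme.{u}} {Y : Over S} (f : Y ⟶ Ga S) : Γ(Y.left, ⊤) :=
  f.left.appTop (gaCoord S)

theorem gaFunction_comp {S : Scheme.{u}} {Y Z : Over S} (g : Y ⟶ Z) (f : Z ⟶ Ga S) :
    gaFunction (g ≫ f) = g.left.appTop (gaFunction f) := by
  rw [gaFunction, Over.comp_left, Scheme.Hom.comp_appTop]
  rfl

theorem gaFunction_lift_mul {S : Scheme.{u}} {Y : Over S} (f g : Y ⟶ Ga S) :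
    gaFunction (lift f g ≫ μ[Ga S]) = gaFunction f + gaFunction g := by
  have h : gaFunction μ[Ga S] = gaFunction (fst (Ga S) (Ga S)) + gaFunction (snd (Ga S) (Ga S)) :=
    AffineSpace.homOfVector_appTop_coord _ _ _
  rw [gaFunction_comp, h, map_add, ← gaFunction_comp, ← gaFunction_comp, lift_fst, lift_snd]

open Polynomial in
/-- The coordinate of the additive group is transcendental. -/
theorem injective_eval₂_gaCoord : Function.Injective
    (eval₂RingHom (scalars (Ga (Spec (CommRingCat.of k))))
      (gaCoord (Spec (CommRingCat.of k)))) := by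
  -- The point of the line with coordinate `X` over `k[X]` gives a left inverse to evaluation.
  let T : Over (Spec (CommRingCat.of k)) := Over.mk (Spec.map (CommRingCat.ofHom (C : k →+* k[X])))
  let e := (Scheme.ΓSpecIso (CommRingCat.of k[X]))
  let f : T ⟶ Ga (Spec (CommRingCat.of k)) :=
    Over.homMk (AffineSpace.homOfVector T.hom fun _ ↦ e.inv X) (AffineSpace.homOfVector_over _ _)
  have hf : f.left.appTop (gaCoord (Spec (CommRingCat.of k))) = e.inv X :=
    AffineSpace.homOfVector_appTop_coord _ _ _
  have hT : scalars T = e.inv.hom.comp C := by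
    have := Scheme.ΓSpecIso_inv_naturality (CommRingCat.ofHom (C : k →+* k[X]))
    exact (congrArg CommRingCat.Hom.hom this).symm
  have hid : (e.hom.hom.comp f.left.appTop.hom).comp (eval₂RingHom (scalars (Ga _))
      (gaCoord (Spec (CommRingCat.of k)))) = RingHom.id k[X] := by
    refine Polynomial.ringHom_ext (fun a ↦ ?_) ?_
    · have h1 := RingHom.congr_fun (appTop_comp_scalars f) a
      rw [hT] at h1
      simp only [RingHom.comp_apply, coe_eval₂RingHom, eval₂_C, RingHom.id_apply] at h1 ⊢
      rw [h1]
      exact e.inv_hom_id_apply (C a)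
    · simp only [RingHom.comp_apply, coe_eval₂RingHom, eval₂_X, RingHom.id_apply]
      exact (congrArg e.hom hf).trans (e.inv_hom_id_apply X)
  refine .of_comp (f := e.hom.hom.comp f.left.appTop.hom) ?_
  rw [← RingHom.coe_comp, hid]
  exact Function.injective_id

/-- The group law of the additive group does not lift along `π : X ⟶ 𝔾_a` if `X` is affine, `π` is
dominant, and the Artin–Schreier equation `y ^ p - y = t ^ 2` is solvable on `X`. -/
theorem comp_ne_tensorHom_comp_mul {p : ℕ} [Fact p.Prime] [CharP k p] (hp : Odd p)
    {X : Over (Spec (CommRingCat.of k))} [IsAffine X.left]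
    (π : X ⟶ UnivCover.Ga (Spec (CommRingCat.of k))) (hinj : Function.Injective π.left.appTop)
    (hy : ∃ y, y ^ p - y = gaFunction π ^ 2) (m : X ⊗ X ⟶ X) :
    m ≫ π ≠ (π ⊗ₘ π) ≫ μ[Ga (Spec (CommRingCat.of k))] := by
  intro hm
  let A := Γ(X.left, ⊤)
  let _ : Algebra k A := (scalars X).toAlgebra
  let R := TensorProduct k A A
  -- `Spec (A ⊗ A)` with its two tautological points `u`, `v` stands in for `X ⊗ X`.
  let T : Over (Spec (CommRingCat.of k)) := Over.mk (Spec.map (CommRingCat.ofHom (algebraMap k R)))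
  let e := Scheme.ΓSpecIso (CommRingCat.of R)
  have hcov (φ : A →ₐ[k] R) : ∃ u : T ⟶ X, ∀ a, e.hom (u.left.appTop a) = φ a := by
    refine ⟨Over.homMk (Spec.map (CommRingCat.ofHom φ.toRingHom) ≫ X.left.isoSpec.inv) ?_, ?_⟩
    · rw [Category.assoc, isoSpec_inv_comp_hom, ← Spec.map_comp,
        ← CommRingCat.ofHom_comp]
      exact congrArg (Spec.map ∘ CommRingCat.ofHom) φ.comp_algebraMap
    · intro a
      have h1 : (Spec.map (CommRingCat.ofHom φ.toRingHom) ≫ X.left.isoSpec.inv).appTop ≫ e.hom =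
          CommRingCat.ofHom φ.toRingHom := by
        rw [Scheme.Hom.comp_appTop, Category.assoc, Scheme.ΓSpecIso_naturality]
        rw [← Category.assoc]
        exact (congrArg (· ≫ CommRingCat.ofHom φ.toRingHom)
          (appTop_isoSpec_inv_comp X.left)).trans (Category.id_comp _)
      exact ConcreteCategory.congr_hom h1 a
  obtain ⟨u, hu⟩ := hcov Algebra.TensorProduct.includeLeft
  obtain ⟨v, hv⟩ := hcov Algebra.TensorProduct.includeRight
  obtain ⟨y, hy⟩ := hy
  let n := lift u v ≫ m
  let ν : A →+* R := e.hom.hom.comp n.left.appTop.hom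
  have hn : n ≫ π = lift (u ≫ π) (v ≫ π) ≫ μ[Ga (Spec (CommRingCat.of k))] := by
    simp [n, hm]
  let t : A := gaFunction π
  have hνt : ν t = t ⊗ₜ[k] 1 + 1 ⊗ₜ[k] t := by
    have := congrArg e.hom (congrArg gaFunction hn)
    rw [gaFunction_lift_mul, map_add, gaFunction_comp, gaFunction_comp, gaFunction_comp, hu, hv]
      at this
    exact this
  have ht : LinearIndependent k fun i : ℕ ↦ t ^ i := by
    have h1 : (Polynomial.aeval t : _ →ₐ[k] A).toRingHom = π.left.appTop.hom.comp
        (Polynomial.eval₂RingHom (scalars (Ga _))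
          (gaCoord (Spec (CommRingCat.of k)))) := by
      refine Polynomial.ringHom_ext (fun a ↦ ?_) ?_
      · refine (Polynomial.aeval_C t a).trans ?_
        rw [RingHom.comp_apply, Polynomial.coe_eval₂RingHom, Polynomial.eval₂_C]
        exact (RingHom.congr_fun (appTop_comp_scalars π) a).symm
      · simp [t, gaFunction]
    have h2 : Function.Injective (Polynomial.aeval t : _ →ₐ[k] A).toRingHom := by
      rw [h1]
      exact hinj.comp injective_eval₂_gaCoord
    simpa [Function.comp_def] using (Polynomial.basisMonomials k).linearIndependent.map'
      (Polynomial.aeval t).toLinearMap (LinearMap.ker_eq_bot.2 h2)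
  have hp2 : (2 : k) ≠ 0 := by
    have h2 : p ≠ 2 := by rintro rfl; exact absurd hp (by decide)
    exact_mod_cast (CharP.cast_eq_zero_iff k p 2).not.2 fun h ↦
      h2 ((Nat.prime_dvd_prime_iff_eq Fact.out Nat.prime_two).1 h)
  -- The witness is the failure of `y` to be additive.
  refine pow_sub_ne_smul_tmul p hp2 ht (ν y - y ⊗ₜ 1 - 1 ⊗ₜ y) ?_
  have : Nontrivial A := ⟨_, _, ht.ne_zero 0⟩
  have : ExpChar k p := .prime Fact.out
  have : ExpChar R p := expChar_of_injective_algebraMap (algebraMap k R).injective p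
  have hνy : ν y ^ p - ν y = (t ⊗ₜ[k] 1 + 1 ⊗ₜ[k] t) ^ 2 := by
    rw [← hνt, ← map_pow, ← map_pow, ← map_sub, hy]
  have hl : (y ⊗ₜ[k] 1) ^ p - y ⊗ₜ[k] 1 = (t ⊗ₜ[k] 1 : R) ^ 2 := by
    rw [Algebra.TensorProduct.tmul_pow, Algebra.TensorProduct.tmul_pow, one_pow, one_pow,
      ← TensorProduct.sub_tmul, hy]
  have hr : (1 ⊗ₜ[k] y) ^ p - 1 ⊗ₜ[k] y = (1 ⊗ₜ[k] t : R) ^ 2 := by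
    rw [Algebra.TensorProduct.tmul_pow, Algebra.TensorProduct.tmul_pow, one_pow, one_pow,
      ← TensorProduct.tmul_sub, hy]
  have hmul : (t ⊗ₜ[k] 1 : R) * 1 ⊗ₜ[k] t = t ⊗ₜ[k] t := by simp
  rw [sub_pow_expChar, sub_pow_expChar, ← hmul, Algebra.smul_def, map_ofNat]
  linear_combination hνy - hl - hr

end

end UnivCover

theorem mainTheorem5 (k : Type u) [Field k] (p : ℕ) [Fact p.Prime] [CharP k p] (hp : Odd p)
    (X : Over (Spec (CommRingCat.of k)))
    (π : X ⟶ UnivCover.Ga (Spec (CommRingCat.of k)))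
    (hπ : UnivCover.IsUniversalCover π.left) :
    (¬ ∃ m : X ⊗ X ⟶ X, m ≫ π = (π ⊗ₘ π) ≫ μ[UnivCover.Ga (Spec (CommRingCat.of k))]) ∧
    (¬ ∃ _ : GrpObj X, IsMonHom π) := by
  have h : ∀ m : X ⊗ X ⟶ X, m ≫ π ≠ (π ⊗ₘ π) ≫ μ[UnivCover.Ga (Spec (CommRingCat.of k))] := by
    intro m
    have : IsAffine (UnivCover.Ga (Spec (CommRingCat.of k))).left :=
      inferInstanceAs (IsAffine 𝔸(PUnit.{u + 1}; Spec (CommRingCat.of k)))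
    have : IsIntegral (UnivCover.Ga (Spec (CommRingCat.of k))).left :=
      inferInstanceAs (IsIntegral 𝔸(PUnit.{u + 1}; Spec (CommRingCat.of k)))
    have : Nonempty X.left := hπ.2.1.toNonempty
    obtain ⟨hX, hinj⟩ := hπ.1.isAffine_and_injective
    refine UnivCover.comp_ne_tensorHom_comp_mul hp π hinj (hπ.2.exists_pow_sub_eq
      (Fact.out : p.Prime).two_le ?_ _) m
    rw [← map_natCast (UnivCover.scalars X), CharP.cast_eq_zero, map_zero]
  exact ⟨fun ⟨m, hm⟩ ↦ h m hm, fun ⟨_, _⟩ ↦ h μ[X] (IsMonHom.mul_hom π)⟩
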